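/- Let $M$ be a smooth manifold with tangent bundle $T$, let $H$ be a closed $3$-form on $M$, and equip $T\oplus T^*$ with the pairing $\langle X+\alpha,Y+\beta\rangle=\alpha(Y)+\beta(X)$ and the $H$-twisted Dorfman bracket $$[X+\alpha,Y+\beta]_H=[X,Y]+\mathcal L_X\beta-\iota_Y d\alpha+\iota_Y\iota_X H .$$ A generalized almost para-complex structure is a smooth $\mathcal K\in\mathrm{End}(T\oplus T^*)$ with $\mathcal K^2=1$ and $\langle\mathcal K\cdot,\mathcal K\cdot\rangle=-\langle\cdot,\cdot\rangle$; it is Courant integrable if both its $(\pm1)$-eigenbundles are involutive under $[\ ,\ ]_H$. A generalized (indefinite) metric is a smooth $\mathcal G\in\mathrm{End}(T\oplus T^*)$ with $\mathcal G^2=1$ and $\langle\mathcal G\cdot,\mathcal G\cdot\rangle=\langle\cdot,\cdot\rangle$ such that the projection $T\oplus T^*\to T$ restricts to an isomorphism on each $(\pm1)$-eigenbundle $C_\pm$ of $\mathcal G$. It can then be written as $$\mathcal G=e^{b}\begin{pmatrix}0&\eta^{-1}\\ \eta&0\end{pmatrix}e^{-b}$$ with a pseudo-Riemannian metric $\eta$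 and a $2$-form $b$, where $e^b(X+\alpha)=X+b(X)+\alpha$. Put $C(X+\alpha)=X+2b(X)-\alpha$. Writing $u=u_++u_-$ for the decomposition of a section along $C_+\oplus C_-$ (and $[u,v]_{H\pm}$ for the $C_\pm$-component of $[u,v]_H$), the generalized Bismut connection of $\mathcal G$ is $$D_uv=[u_-,v_+]_{H+}+[u_+,v_-]_{H-}+[Cu_-,v_-]_{H-}+[Cu_+,v_+]_{H+},$$ and its generalized torsion is $$T^D(u,v,w)=\langle D_uv-D_vu-[u,v]_H,w\rangle+\langle D_wu,v\rangle .$$ A (twisted) generalized para-K\"ahler (GpK) structure is a commuting pair $(\mathcal G,\mathcal K)$ of a generalized metric $\mathcal G$ whose $\eta$ has split signature and a generalized almost para-complex structure $\mathcal K$ such that $\mathcal K$ and $\mathcal G\mathcal K$ are both Courant integrable. **Theorem.** Let $\mathcal K_+,\mathcal K_-$ be commuting generalized almost para-complex structures on $M$ such that $\mathcal G=\mathcal K_+\mathcal K_-$ is a generalized metric, and let $D$ be the generalized Bismut connection of $\mathcal G$. Then the following are equivalent: 1. $(\mathcal G,\mathcal K_+)$ is a GpK structure; 2. both $\mathcal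 K_+$ and $\mathcal K_-$ are Courant integrable; 3. $D\mathcal K_+=0$, $D\mathcal K_-=0$, and $T^D$ is of type $(2,1)+(1,2)$ with respect to both $\mathcal K_+$ and $\mathcal K_-$, i.e. for each of them $T^D$ equals the sum of its $(2,1)$ and $(1,2)$ components in the decomposition of $T\oplus T^*$ into the $+1$- and $-1$-eigenbundles. -/

import Mathlib

open scoped Manifold ContDiff Bundle

noncomputable section

namespace GenGeom

variable {E : Type*} [NormedAddCommGroup E] [NormedSpace ℝ E]
  {M : Type*} [TopologicalSpace M] [ChartedSpace E M]

/-! ### Differential forms and the exterior derivative -/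

variable (E M) in
/-- (Not necessarily smooth) differential `k`-forms on `M`. -/
abbrev Form (k : ℕ) : Type _ := Π x : M, TangentSpace 𝓘(ℝ, E) x [⋀^Fin k]→L[ℝ] ℝ

/-- The expression of a form in the preferred chart at `x`, i.e. its pullback under the inverse
chart; it is meaningful on the (open) target of the chart. -/
def Form.inChart {k : ℕ} (θ : Form E M k) (x : M) : E → E [⋀^Fin k]→L[ℝ] ℝ := fun y =>
  (θ ((extChartAt 𝓘(ℝ, E) x).symm y)).compContinuousLinearMap
    (mfderiv 𝓘(ℝ, E) 𝓘(ℝ, E) (extChartAt 𝓘(ℝ, E) x).symm y)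

/-- A form is smooth when all its chart expressions are. -/
def Form.IsSmooth {k : ℕ} (θ : Form E M k) : Prop :=
  ∀ x : M, ContDiffOn ℝ ∞ (θ.inChart x) (extChartAt 𝓘(ℝ, E) x).target

/-- The exterior derivative: at `x`, differentiate the expression of the form in the chart at `x`
and pull the result back to `T_x M`. -/
def Form.d {k : ℕ} (θ : Form E M k) : Form E M (k + 1) := fun x =>
  (extDeriv (θ.inChart x) (extChartAt 𝓘(ℝ, E) x x)).compContinuousLinearMap
    (mfderiv 𝓘(ℝ, E) 𝓘(ℝ, E) (extChartAt 𝓘(ℝ, E) x) x)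

/-- A field of covectors, seen as a form of degree one. -/
def oneForm (α : Π x : M, TangentSpace 𝓘(ℝ, E) x →L[ℝ] ℝ) : Form E M 1 := fun x =>
  ContinuousAlternatingMap.ofSubsingleton ℝ (TangentSpace 𝓘(ℝ, E) x) ℝ (0 : Fin 1) (α x)

/-! ### The generalized tangent bundle `T ⊕ T*` -/

/-- The fibre of `T ⊕ T*`. -/
abbrev GTan (x : M) : Type _ :=
  TangentSpace 𝓘(ℝ, E) x × (TangentSpace 𝓘(ℝ, E) x →L[ℝ] ℝ)

variable (E M) in
/-- Sections of `T ⊕ T*` (smoothness is imposed separately). -/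
abbrev GSec : Type _ := Π x : M, GTan (E := E) x

/-- Smooth sections of the vector bundle `T ⊕ T*`. -/
def GSec.IsSmooth [IsManifold 𝓘(ℝ, E) ∞ M] (u : GSec E M) : Prop :=
  ContMDiff 𝓘(ℝ, E) (𝓘(ℝ, E).prod 𝓘(ℝ, E × (E →L[ℝ] ℝ))) ∞
    (fun x : M => Bundle.TotalSpace.mk' (E × (E →L[ℝ] ℝ))
      (E := (TangentSpace 𝓘(ℝ, E) : M → Type _) ×ᵇ
        fun x : M => TangentSpace 𝓘(ℝ, E) x →L[ℝ] ℝ) x (u x))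

variable (E M) in
/-- Fields of endomorphisms of `T ⊕ T*` (smoothness is imposed separately). -/
abbrev GEnd : Type _ := Π x : M, GTan (E := E) x →L[ℝ] GTan (E := E) x

/-- Smooth sections of the vector bundle `End (T ⊕ T*)`. -/
def GEnd.IsSmooth [IsManifold 𝓘(ℝ, E) ∞ M] (A : GEnd E M) : Prop :=
  ContMDiff 𝓘(ℝ, E)
    (𝓘(ℝ, E).prod 𝓘(ℝ, (E × (E →L[ℝ] ℝ)) →L[ℝ] (E × (E →L[ℝ] ℝ)))) ∞
    (fun x : M => Bundle.TotalSpace.mk' ((E × (E →L[ℝ] ℝ)) →L[ℝ] (E × (E →L[ℝ] ℝ)))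
      (E := fun x : M =>
        ((TangentSpace 𝓘(ℝ, E) : M → Type _) ×ᵇ
          fun x : M => TangentSpace 𝓘(ℝ, E) x →L[ℝ] ℝ) x →L[ℝ]
        ((TangentSpace 𝓘(ℝ, E) : M → Type _) ×ᵇ
          fun x : M => TangentSpace 𝓘(ℝ, E) x →L[ℝ] ℝ) x) x (A x))

/-- The action of an endomorphism field on sections. -/
def GEnd.act (A : GEnd E M) (u : GSec E M) : GSec E M := fun x => A x (u x)

/-- Composition of endomorphism fields. -/
def GEnd.comp (A B : GEnd E M) : GEnd E M := fun x => (A x).comp (B x)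

/-- The pairing `⟨X + α, Y + β⟩ = α(Y) + β(X)`. -/
def pairing {x : M} (u v : GTan (E := E) x) : ℝ := u.2 v.1 + v.2 u.1

/-- The contraction `ι_X θ = θ(X, ·)` of a two-form. -/
def contract {x : M} (θ : TangentSpace 𝓘(ℝ, E) x [⋀^Fin 2]→L[ℝ] ℝ)
    (X : TangentSpace 𝓘(ℝ, E) x) : TangentSpace 𝓘(ℝ, E) x →L[ℝ] ℝ :=
  θ.toContinuousLinearMap ![X, 0] 1

/-- The contraction `ι_Y ι_X θ = θ(X, Y, ·)` of a three-form. -/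
def contractTwo {x : M} (θ : TangentSpace 𝓘(ℝ, E) x [⋀^Fin 3]→L[ℝ] ℝ)
    (X Y : TangentSpace 𝓘(ℝ, E) x) : TangentSpace 𝓘(ℝ, E) x →L[ℝ] ℝ :=
  θ.toContinuousLinearMap ![X, Y, 0] 2

/-- The differential of a function, as a field of covectors. -/
def dFun (f : M → ℝ) (x : M) : TangentSpace 𝓘(ℝ, E) x →L[ℝ] ℝ :=
  mfderiv 𝓘(ℝ, E) 𝓘(ℝ, ℝ) f x

/-- The Lie derivative of a one-form, `L_X β = d(ι_X β) + ι_X dβ`. -/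
def lieOneForm (X : Π x : M, TangentSpace 𝓘(ℝ, E) x)
    (β : Π x : M, TangentSpace 𝓘(ℝ, E) x →L[ℝ] ℝ) (x : M) :
    TangentSpace 𝓘(ℝ, E) x →L[ℝ] ℝ :=
  dFun (fun y => β y (X y)) x + contract ((oneForm β).d x) (X x)

/-- The `H`-twisted Dorfman bracket
`[X + α, Y + β]_H = [X, Y] + L_X β - ι_Y dα + ι_Y ι_X H`. -/
def dorfman (H : Form E M 3) (u v : GSec E M) : GSec E M := fun x =>
  (VectorField.mlieBracket 𝓘(ℝ, E) (fun y => (u y).1) (fun y => (v y).1) x,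
    lieOneForm (fun y => (u y).1) (fun y => (v y).2) x
      - contract ((oneForm fun y => (u y).2).d x) (v x).1
      + contractTwo (H x) (u x).1 (v x).1)

/-! ### Generalized structures -/

/-- Generalized almost para-complex structures: `K² = 1` and `⟨K·, K·⟩ = -⟨·, ·⟩`. -/
structure IsAlmostGpC [IsManifold 𝓘(ℝ, E) ∞ M] (K : GEnd E M) : Prop where
  smooth : K.IsSmooth
  sq : ∀ x (w : GTan (E := E) x), K x (K x w) = w
  anti : ∀ x (w z : GTan (E := E) x), pairing (K x w) (K x z) = -pairing w z

/-- Courant integrability of a para-complex structure with respect to the `H`-twisted Dorfman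
bracket: both eigenbundles are involutive. -/
structure IsCourantIntegrable [IsManifold 𝓘(ℝ, E) ∞ M] (H : Form E M 3) (K : GEnd E M) :
    Prop where
  plus : ∀ u v : GSec E M, u.IsSmooth → v.IsSmooth →
    (∀ x, K x (u x) = u x) → (∀ x, K x (v x) = v x) →
    ∀ x, K x (dorfman H u v x) = dorfman H u v x
  minus : ∀ u v : GSec E M, u.IsSmooth → v.IsSmooth →
    (∀ x, K x (u x) = -u x) → (∀ x, K x (v x) = -v x) →
    ∀ x, K x (dorfman H u v x) = -dorfman H u v x

/-- Generalized (indefinite) metrics: generalized product structures `G` (`G² = 1` and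
`⟨G·, G·⟩ = ⟨·, ·⟩`) that are non-degenerate, i.e. the anchor `X + α ↦ X` maps both
eigenbundles isomorphically onto the tangent bundle. -/
structure IsGenMetric [IsManifold 𝓘(ℝ, E) ∞ M] (G : GEnd E M) : Prop where
  smooth : G.IsSmooth
  sq : ∀ x (w : GTan (E := E) x), G x (G x w) = w
  orth : ∀ x (w z : GTan (E := E) x), pairing (G x w) (G x z) = pairing w z
  nondeg_plus : ∀ x, Set.BijOn Prod.fst {w : GTan (E := E) x | G x w = w} Set.univ
  nondeg_minus : ∀ x, Set.BijOn Prod.fst {w : GTan (E := E) x | G x w = -w} Set.univ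

/-- The pseudo-Riemannian metric `η` underlying a generalized metric
`G = e^b (0, η⁻¹; η, 0) e^{-b}`: the inverse of the block `T* → T` of `G`. -/
def GEnd.metric (G : GEnd E M) (x : M) :
    TangentSpace 𝓘(ℝ, E) x →L[ℝ] (TangentSpace 𝓘(ℝ, E) x →L[ℝ] ℝ) :=
  ContinuousLinearMap.inverse
    ((ContinuousLinearMap.fst ℝ _ _).comp ((G x).comp (ContinuousLinearMap.inr ℝ _ _)))

/-- The two-form `b = -η A` underlying a generalized metric, where `A` is the block `T → T`. -/
def GEnd.bField (G : GEnd E M) (x : M) :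
    TangentSpace 𝓘(ℝ, E) x →L[ℝ] (TangentSpace 𝓘(ℝ, E) x →L[ℝ] ℝ) :=
  -((G.metric x).comp
    ((ContinuousLinearMap.fst ℝ _ _).comp ((G x).comp (ContinuousLinearMap.inl ℝ _ _))))

/-- The metric underlying a generalized metric has signature `(n, n)`. -/
def GEnd.IsSplit (G : GEnd E M) : Prop :=
  ∀ x : M, ∃ P N : Submodule ℝ (TangentSpace 𝓘(ℝ, E) x), IsCompl P N ∧
    Module.finrank ℝ P = Module.finrank ℝ N ∧
    (∀ v ∈ P, v ≠ 0 → 0 < G.metric x v v) ∧ (∀ v ∈ N, v ≠ 0 → G.metric x v v < 0)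

/-- `(G, K)` is a (twisted) generalized para-Kähler structure. -/
structure IsGpK [IsManifold 𝓘(ℝ, E) ∞ M] (H : Form E M 3) (G K : GEnd E M) : Prop where
  metric : IsGenMetric G
  split : G.IsSplit
  para : IsAlmostGpC K
  comm : G.comp K = K.comp G
  integrable : IsCourantIntegrable H K
  integrable' : IsCourantIntegrable H (G.comp K)

/-! ### The generalized Bismut connection and its torsion -/

/-- The `+1`-eigenbundle component `½ (1 + A) u` of a section. -/
def GEnd.projPlus (A : GEnd E M) (u : GSec E M) : GSec E M := fun x =>
  (1 / 2 : ℝ) • (u x + A x (u x))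

/-- The `-1`-eigenbundle component `½ (1 - A) u` of a section. -/
def GEnd.projMinus (A : GEnd E M) (u : GSec E M) : GSec E M := fun x =>
  (1 / 2 : ℝ) • (u x - A x (u x))

/-- The operator `C (X + α) = X + 2 b X - α` of a generalized metric, which exchanges the two
eigenbundles of `G`. -/
def GEnd.swap (G : GEnd E M) (u : GSec E M) : GSec E M := fun x =>
  ((u x).1, (2 : ℝ) • G.bField x (u x).1 - (u x).2)

/-- The generalized Bismut connection
`D_u v = [u₋, v₊]₊ + [u₊, v₋]₋ + [C u₋, v₋]₋ + [C u₊, v₊]₊` of a generalized metric `G`. -/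
def bismut (H : Form E M 3) (G : GEnd E M) (u v : GSec E M) : GSec E M :=
  G.projPlus (dorfman H (G.projMinus u) (G.projPlus v))
    + G.projMinus (dorfman H (G.projPlus u) (G.projMinus v))
    + G.projMinus (dorfman H (G.swap (G.projMinus u)) (G.projMinus v))
    + G.projPlus (dorfman H (G.swap (G.projPlus u)) (G.projPlus v))

/-- `D K = 0`, i.e. `D_u (K v) = K (D_u v)` for all sections. -/
def IsParallel [IsManifold 𝓘(ℝ, E) ∞ M] (D : GSec E M → GSec E M → GSec E M)
    (K : GEnd E M) : Prop :=
  ∀ u v : GSec E M, u.IsSmooth → v.IsSmooth → D u (K.act v) = K.act (D u v)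

/-- The generalized torsion
`T^D(u, v, w) = ⟨D_u v - D_v u - [u, v]_H, w⟩ + ⟨D_w u, v⟩`. -/
def genTorsion (H : Form E M 3) (D : GSec E M → GSec E M → GSec E M)
    (u v w : GSec E M) (x : M) : ℝ :=
  pairing (D u v x - D v u x - dorfman H u v x) (w x) + pairing (D w u x) (v x)

/-- The `(2,1)` component of a tensor with respect to `K`: two arguments are projected to the
`+1`-eigenbundle and one to the `-1`-eigenbundle. -/
def component21 (T : GSec E M → GSec E M → GSec E M → M → ℝ) (K : GEnd E M)
    (u v w : GSec E M) (x : M) : ℝ :=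
  T (K.projPlus u) (K.projPlus v) (K.projMinus w) x
    + T (K.projPlus u) (K.projMinus v) (K.projPlus w) x
    + T (K.projMinus u) (K.projPlus v) (K.projPlus w) x

/-- The `(1,2)` component of a tensor with respect to `K`: one argument is projected to the
`+1`-eigenbundle and two to the `-1`-eigenbundle. -/
def component12 (T : GSec E M → GSec E M → GSec E M → M → ℝ) (K : GEnd E M)
    (u v w : GSec E M) (x : M) : ℝ :=
  T (K.projPlus u) (K.projMinus v) (K.projMinus w) x
    + T (K.projMinus u) (K.projPlus v) (K.projMinus w) x
    + T (K.projMinus u) (K.projMinus v) (K.projPlus w) x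

/-- The tensor `T` is of type `(2,1) + (1,2)` with respect to `K`. -/
def IsOfType21Add12 [IsManifold 𝓘(ℝ, E) ∞ M]
    (T : GSec E M → GSec E M → GSec E M → M → ℝ) (K : GEnd E M) : Prop :=
  ∀ u v w : GSec E M, u.IsSmooth → v.IsSmooth → w.IsSmooth → ∀ x,
    T u v w x = component21 T K u v w x + component12 T K u v w x

end GenGeom

end

open scoped Manifold ContDiff Bundle
open Bundle
noncomputable section
namespace GenGeom
variable {E : Type*} [NormedAddCommGroup E] [NormedSpace ℝ E]
  {M : Type*} [TopologicalSpace M] [ChartedSpace E M]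

/-! ### Smooth sections of `T ⊕ T*` -/

section

/-! Let C₊ and C₋ be the eigenbundles of G = K₊K₋, and split them by the joint eigenvalues of (K₊,
K₋): C₊ consists of the types (+,+) and (-,-), C₋ of (+,-) and (-,+). A type in C₋ and a type in C₊
always share exactly one of the two eigenvalues. If a in C₋ and v in C₊ have pure types,
integrability of the structure whose eigenvalue they share keeps [a, v] in the corresponding
eigenbundle. Since K₊ = K₋ on C₊, the component [a, v]₊ then has the same type as v. The same holds
with C₊ and C₋ exchanged. As C interchanges C₊ and C₋, all four terms of D have this form, so D
preserves K₊ and K₋ (`projPlus_dorfman_act`, `isParallel_bismut`).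

Once DK = 0, integrability of K is the vanishing of the (3,0) and (0,3) parts of the torsion. An
eigenbundle ℓ of K is maximal isotropic and preserved by D, so T(u, v, w) = -⟨[u, v], w⟩ for u, v, w
in ℓ; this vanishes for all w exactly when [u, v] lies in ℓ^⊥ = ℓ (`genTorsion_eq_zero`,
`involutive_of_isOfType`).

Finally GK₊ = K₋, and the signature condition in GpK is automatic: K₊ restricted to C₊ ≅ T is an
involution reversing the sign of η (`IsGenMetric.isSplit`).

The bracket is additive only on differentiable sections, so all sections that occur, including Cu,
must be shown smooth. -/

/-- Smoothness of a field of covectors. -/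
def IsSmoothCovector [IsManifold 𝓘(ℝ, E) ∞ M]
    (α : Π x : M, TangentSpace 𝓘(ℝ, E) x →L[ℝ] ℝ) : Prop :=
  ContMDiff 𝓘(ℝ, E) (𝓘(ℝ, E).prod 𝓘(ℝ, E →L[ℝ] ℝ)) ∞
    (fun x : M => TotalSpace.mk' (E →L[ℝ] ℝ)
      (E := fun x : M => TangentSpace 𝓘(ℝ, E) x →L[ℝ] ℝ) x (α x))

variable [IsManifold 𝓘(ℝ, E) ∞ M]

lemma GSec.isSmooth_iff (u : GSec E M) : u.IsSmooth ↔
    ContMDiff 𝓘(ℝ, E) (𝓘(ℝ, E).prod 𝓘(ℝ, E)) ∞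
      (fun x : M => TotalSpace.mk' E (E := (TangentSpace 𝓘(ℝ, E) : M → Type _)) x (u x).1) ∧
    IsSmoothCovector (fun x => (u x).2) := by
  simp only [GSec.IsSmooth, IsSmoothCovector, ContMDiff, contMDiffAt_section, ← forall_and]
  refine forall_congr' fun x => ?_
  exact contMDiffAt_prod_module_iff _

lemma GSec.IsSmooth.add {u v : GSec E M} (hu : u.IsSmooth) (hv : v.IsSmooth) : (u + v).IsSmooth :=
  ContMDiff.add_section hu hv

lemma GSec.IsSmooth.neg {u : GSec E M} (hu : u.IsSmooth) : (-u).IsSmooth :=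
  ContMDiff.neg_section hu

lemma GSec.IsSmooth.sub {u v : GSec E M} (hu : u.IsSmooth) (hv : v.IsSmooth) : (u - v).IsSmooth :=
  ContMDiff.sub_section hu hv

lemma GSec.IsSmooth.const_smul (c : ℝ) {u : GSec E M} (hu : u.IsSmooth) : (c • u).IsSmooth :=
  ContMDiff.const_smul_section hu

lemma GEnd.IsSmooth.act {K : GEnd E M} (hK : K.IsSmooth) {u : GSec E M} (hu : u.IsSmooth) :
    (K.act u).IsSmooth :=
  ContMDiff.clm_bundle_apply hK hu

/-- A local smooth extension times a bump function. This lets pointwise non-degeneracy of the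
pairing be tested against global smooth sections. -/
lemma GSec.exists_isSmooth_eq [FiniteDimensional ℝ E] [T2Space M] (x : M) (w : GTan (E := E) x) :
    ∃ u : GSec E M, u.IsSmooth ∧ u x = w := by
  obtain ⟨s, hs, h⟩ := FiberBundle.exists_contMDiffOn_extend (k := ∞) 𝓘(ℝ, E)
    (V := (TangentSpace 𝓘(ℝ, E) : M → Type _) ×ᵇ
        fun x : M => TangentSpace 𝓘(ℝ, E) x →L[ℝ] ℝ) (E × (E →L[ℝ] ℝ)) w
  have := mem_interior_iff_mem_nhds.2 hs
  obtain ⟨f, -, hf⟩ := (SmoothBumpFunction.nhds_basis_tsupport (I := 𝓘(ℝ, E)) x).mem_iff.1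
    (isOpen_interior.mem_nhds this)
  refine ⟨_, ContMDiffOn.smul_section_of_tsupport (ψ := f) f.contMDiff.contMDiffOn
    isOpen_interior hf (h.mono interior_subset), ?_⟩
  simp

end

/-! ### Additivity of contractions, of the exterior derivative and of the Dorfman bracket -/

section

lemma contract_add {x : M} (θ θ' : TangentSpace 𝓘(ℝ, E) x [⋀^Fin 2]→L[ℝ] ℝ)
    (X : TangentSpace 𝓘(ℝ, E) x) : contract (θ + θ') X = contract θ X + contract θ' X := rfl

lemma contract_apply {x : M} (θ : TangentSpace 𝓘(ℝ, E) x [⋀^Fin 2]→L[ℝ] ℝ)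
    (X Y : TangentSpace 𝓘(ℝ, E) x) : contract θ X Y = θ ![X, Y] := by
  change θ (Function.update ![X, 0] 1 Y) = _
  congr 1; ext i; fin_cases i <;> simp

lemma contract_vec_add {x : M} (θ : TangentSpace 𝓘(ℝ, E) x [⋀^Fin 2]→L[ℝ] ℝ)
    (X X' : TangentSpace 𝓘(ℝ, E) x) : contract θ (X + X') = contract θ X + contract θ X' := by
  ext Y
  simp only [contract_apply, _root_.add_apply]
  exact θ.toMultilinearMap.cons_add ![Y] X X'

lemma contractTwo_apply {x : M} (θ : TangentSpace 𝓘(ℝ, E) x [⋀^Fin 3]→L[ℝ] ℝ)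
    (X Y Z : TangentSpace 𝓘(ℝ, E) x) : contractTwo θ X Y Z = θ ![X, Y, Z] := by
  change θ (Function.update ![X, Y, 0] 2 Z) = _
  congr 1; ext i; fin_cases i <;> simp [Function.update]

lemma contractTwo_add_left {x : M} (θ : TangentSpace 𝓘(ℝ, E) x [⋀^Fin 3]→L[ℝ] ℝ)
    (X X' Y : TangentSpace 𝓘(ℝ, E) x) :
    contractTwo θ (X + X') Y = contractTwo θ X Y + contractTwo θ X' Y := by
  ext Z
  simp only [contractTwo_apply, _root_.add_apply]
  exact θ.toMultilinearMap.cons_add ![Y, Z] X X'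

lemma contractTwo_add_right {x : M} (θ : TangentSpace 𝓘(ℝ, E) x [⋀^Fin 3]→L[ℝ] ℝ)
    (X Y Y' : TangentSpace 𝓘(ℝ, E) x) :
    contractTwo θ X (Y + Y') = contractTwo θ X Y + contractTwo θ X Y' := by
  -- Antisymmetry in the first two slots reduces the claim to additivity in the first.
  have h (V : TangentSpace 𝓘(ℝ, E) x) : contractTwo θ X V = -contractTwo θ V X := by
    ext Z
    simp only [contractTwo_apply, _root_.neg_apply]
    refine Eq.trans ?_ (θ.map_swap ![V, X, Z] (show (0 : Fin 3) ≠ 1 by decide))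
    refine congrArg θ (funext fun i => ?_)
    fin_cases i <;> simp [Equiv.swap_apply_def]
  rw [h, contractTwo_add_left, h Y, h Y', neg_add]

variable [IsManifold 𝓘(ℝ, E) ∞ M]

/-- The inverse of the tangent trivialization is the derivative of the inverse chart, so near the
base point `inChart` is the coordinate expression of `α` in the cotangent trivialization. -/
lemma IsSmoothCovector.differentiableAt_inChart
    {α : Π x : M, TangentSpace 𝓘(ℝ, E) x →L[ℝ] ℝ} (hα : IsSmoothCovector α) (x : M) :
    DifferentiableAt ℝ ((oneForm α).inChart x) (extChartAt 𝓘(ℝ, E) x x) := by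
  have h := (contMDiffAt_section x).1 (hα x)
  rw [contMDiffAt_iff] at h
  have h2 := h.2
  simp only [modelWithCornersSelf_coe, Set.range_id, contDiffWithinAt_univ] at h2
  have h3 := (ContinuousAlternatingMap.ofSubsingletonLIE (𝕜 := ℝ) (E := E) (F := ℝ)
    (0 : Fin 1)).toContinuousLinearEquiv.differentiable.differentiableAt.comp _
      (h2.differentiableAt (by simp))
  refine h3.congr_of_eventuallyEq ?_
  have : (extChartAt 𝓘(ℝ, E) x).target ∈ nhds (extChartAt 𝓘(ℝ, E) x x) :=
    extChartAt_target_mem_nhds x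
  filter_upwards [this] with y hy
  have hs := (extChartAt 𝓘(ℝ, E) x).map_target hy
  have hs' : (extChartAt 𝓘(ℝ, E) x).symm y ∈ (chartAt E x).source := by
    simpa using hs
  have e := TangentBundle.symmL_trivializationAt (I := 𝓘(ℝ, E)) hs'
  rw [(extChartAt 𝓘(ℝ, E) x).right_inv hy] at e
  simp only [modelWithCornersSelf_coe, Set.range_id, mfderivWithin_univ] at e
  ext v
  change α _ (mfderiv 𝓘(ℝ, E) 𝓘(ℝ, E) (extChartAt 𝓘(ℝ, E) x).symm y (v 0)) =
    ((trivializationAt ℝ (Bundle.Trivial M ℝ) x).continuousLinearMapAt ℝ _)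
      (α _ ((trivializationAt E (TangentSpace 𝓘(ℝ, E)) x).symmL ℝ
        ((extChartAt 𝓘(ℝ, E) x).symm y) (v 0)))
  rw [e]
  exact (DFunLike.congr_fun (Bundle.Trivial.continuousLinearMapAt_trivialization ℝ M ℝ _) _).symm

lemma oneForm_d_add {α β : Π x : M, TangentSpace 𝓘(ℝ, E) x →L[ℝ] ℝ} (hα : IsSmoothCovector α)
    (hβ : IsSmoothCovector β) (x : M) :
    (oneForm fun y => α y + β y).d x = (oneForm α).d x + (oneForm β).d x := by
  have : (oneForm fun y => α y + β y).inChart x = (oneForm α).inChart x + (oneForm β).inChart x :=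
    rfl
  simp only [Form.d, this]
  rw [extDeriv_add (hα.differentiableAt_inChart x) (hβ.differentiableAt_inChart x)]
  rfl

lemma IsSmoothCovector.mdifferentiableAt_apply {α : Π x : M, TangentSpace 𝓘(ℝ, E) x →L[ℝ] ℝ}
    (hα : IsSmoothCovector α) {X : Π x : M, TangentSpace 𝓘(ℝ, E) x}
    (hX : ContMDiff 𝓘(ℝ, E) (𝓘(ℝ, E).prod 𝓘(ℝ, E)) ∞
      (fun x : M => TotalSpace.mk' E (E := (TangentSpace 𝓘(ℝ, E) : M → Type _)) x (X x))) (x : M) :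
    MDifferentiableAt 𝓘(ℝ, E) 𝓘(ℝ, ℝ) (fun y => α y (X y)) x := by
  have h : ContMDiff 𝓘(ℝ, E) (𝓘(ℝ, E).prod 𝓘(ℝ, ℝ)) ∞
      (fun x : M => TotalSpace.mk' ℝ (E := Bundle.Trivial M ℝ) x (α x (X x))) :=
    ContMDiff.clm_bundle_apply hα hX
  exact ((contMDiffAt_section x).1 (h x)).mdifferentiableAt (by simp)

omit [IsManifold 𝓘(ℝ, E) ∞ M] in
lemma dFun_add {f g : M → ℝ} {x : M} (hf : MDifferentiableAt 𝓘(ℝ, E) 𝓘(ℝ, ℝ) f x)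
    (hg : MDifferentiableAt 𝓘(ℝ, E) 𝓘(ℝ, ℝ) g x) :
    dFun (E := E) (fun y => f y + g y) x = dFun f x + dFun g x :=
  mfderiv_add hf hg

lemma dorfman_add_left [CompleteSpace E] (H : Form E M 3) {u u' v : GSec E M}
    (hu : u.IsSmooth) (hu' : u'.IsSmooth) (hv : v.IsSmooth) :
    dorfman H (u + u') v = dorfman H u v + dorfman H u' v := by
  rw [GSec.isSmooth_iff] at hu hu' hv
  funext x
  refine Prod.ext ?_ ?_
  · exact VectorField.mlieBracket_add_left ((hu.1 x).mdifferentiableAt (by simp))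
      ((hu'.1 x).mdifferentiableAt (by simp))
  · simp only [dorfman, lieOneForm, Pi.add_apply, Prod.fst_add, Prod.snd_add, map_add]
    rw [dFun_add (hv.2.mdifferentiableAt_apply hu.1 x) (hv.2.mdifferentiableAt_apply hu'.1 x),
      oneForm_d_add hu.2 hu'.2, contract_add, contract_vec_add, contractTwo_add_left]
    abel

lemma dorfman_add_right [CompleteSpace E] (H : Form E M 3) {u v v' : GSec E M}
    (hu : u.IsSmooth) (hv : v.IsSmooth) (hv' : v'.IsSmooth) :
    dorfman H u (v + v') = dorfman H u v + dorfman H u v' := by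
  rw [GSec.isSmooth_iff] at hu hv hv'
  funext x
  refine Prod.ext ?_ ?_
  · exact VectorField.mlieBracket_add_right ((hv.1 x).mdifferentiableAt (by simp))
      ((hv'.1 x).mdifferentiableAt (by simp))
  · simp only [dorfman, lieOneForm, Pi.add_apply, Prod.fst_add, Prod.snd_add,
      _root_.add_apply]
    rw [dFun_add (hv.2.mdifferentiableAt_apply hu.1 x) (hv'.2.mdifferentiableAt_apply hu.1 x),
      oneForm_d_add hv.2 hv'.2, contract_add, contract_vec_add, contractTwo_add_right]
    abel

end

/-! ### Linear algebra of the pairing, of generalized metrics and of the operator `C` -/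

section

lemma GEnd.apply_zero (A : GEnd E M) (x : M) : A x 0 = 0 := ContinuousLinearMap.map_zero _

lemma GEnd.apply_add (A : GEnd E M) (x : M) (w z : GTan (E := E) x) :
    A x (w + z) = A x w + A x z := ContinuousLinearMap.map_add _ w z

lemma GEnd.apply_neg (A : GEnd E M) (x : M) (w : GTan (E := E) x) :
    A x (-w) = -A x w := ContinuousLinearMap.map_neg (A x) w

lemma GEnd.apply_sub (A : GEnd E M) (x : M) (w z : GTan (E := E) x) :
    A x (w - z) = A x w - A x z := ContinuousLinearMap.map_sub (A x) w z

lemma GEnd.apply_smul (A : GEnd E M) (x : M) (c : ℝ) (w : GTan (E := E) x) :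
    A x (c • w) = c • A x w := ContinuousLinearMap.map_smul (A x) c w

lemma pairing_comm {x : M} (u v : GTan (E := E) x) : pairing u v = pairing v u := add_comm _ _

lemma pairing_add_left {x : M} (u u' v : GTan (E := E) x) :
    pairing (u + u') v = pairing u v + pairing u' v := by
  simp only [pairing, Prod.fst_add, Prod.snd_add, map_add, _root_.add_apply]; ring

lemma pairing_neg_left {x : M} (u v : GTan (E := E) x) : pairing (-u) v = -pairing u v := by
  simp only [pairing, Prod.fst_neg, Prod.snd_neg, map_neg, _root_.neg_apply]; ring

lemma pairing_add_right {x : M} (u v v' : GTan (E := E) x) :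
    pairing u (v + v') = pairing u v + pairing u v' := by
  rw [pairing_comm, pairing_add_left, pairing_comm v, pairing_comm v']

lemma pairing_neg_right {x : M} (u v : GTan (E := E) x) : pairing u (-v) = -pairing u v := by
  rw [pairing_comm, pairing_neg_left, pairing_comm]

/-- The pairing is non-degenerate. -/
lemma eq_zero_of_pairing_eq_zero {x : M} {u : GTan (E := E) x} (h : ∀ v, pairing u v = 0) :
    u = 0 := by
  refine Prod.ext ?_ ?_
  · have h' (f : E →L[ℝ] ℝ) : f u.1 = 0 := by
      have := h (0, f)
      simp only [pairing, map_zero, zero_add] at this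
      exact this
    exact SeparatingDual.eq_zero_of_forall_dual_eq_zero (R := ℝ) (V := E) h'
  · ext Y
    simpa [pairing] using h (Y, 0)

/-- The block `T* → T` of an endomorphism of `T ⊕ T*`. -/
def GEnd.block (G : GEnd E M) (x : M) :
    (TangentSpace 𝓘(ℝ, E) x →L[ℝ] ℝ) →L[ℝ] TangentSpace 𝓘(ℝ, E) x :=
  (ContinuousLinearMap.fst ℝ _ _).comp ((G x).comp (ContinuousLinearMap.inr ℝ _ _))

variable [IsManifold 𝓘(ℝ, E) ∞ M]

lemma IsGenMetric.eq_zero_of_plus {G : GEnd E M} (hG : IsGenMetric G) {x : M}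
    {w : GTan (E := E) x} (h : G x w = w) (h0 : w.1 = 0) : w = 0 :=
  (hG.nondeg_plus x).injOn h (G.apply_zero x) h0

lemma IsGenMetric.eq_zero_of_minus {G : GEnd E M} (hG : IsGenMetric G) {x : M}
    {w : GTan (E := E) x} (h : G x w = -w) (h0 : w.1 = 0) : w = 0 :=
  (hG.nondeg_minus x).injOn h (show G x 0 = -0 by rw [G.apply_zero, neg_zero]) h0

/-- The vector w + Gw lies in C₊ and has zero anchor, hence vanishes. Membership in C₋ can thus be
tested on tangent components alone. -/
lemma IsGenMetric.eq_neg_of_fst {G : GEnd E M} (hG : IsGenMetric G) {x : M}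
    {w : GTan (E := E) x} (h : (G x w).1 = -w.1) : G x w = -w := by
  refine eq_neg_of_add_eq_zero_left (hG.eq_zero_of_plus ?_ ?_)
  · rw [G.apply_add, hG.sq, add_comm]
  · simp [h]

lemma IsGenMetric.eq_self_of_fst {G : GEnd E M} (hG : IsGenMetric G) {x : M}
    {w : GTan (E := E) x} (h : (G x w).1 = w.1) : G x w = w := by
  refine sub_eq_zero.1 (hG.eq_zero_of_minus ?_ ?_)
  · rw [G.apply_sub, hG.sq, neg_sub]
  · simp [h]

lemma IsGenMetric.self_adjoint {G : GEnd E M} (hG : IsGenMetric G) {x : M}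
    (w z : GTan (E := E) x) : pairing (G x w) z = pairing w (G x z) := by
  rw [← hG.orth x w (G x z), hG.sq]

lemma IsGenMetric.block_injective {G : GEnd E M} (hG : IsGenMetric G) (x : M) :
    Function.Injective (G.block x) := by
  rw [injective_iff_map_eq_zero]
  intro ξ hξ
  -- A covector killed by the block lies in C₋, where the anchor is injective.
  have h1 : G x (0, ξ) = -(0, ξ) := hG.eq_neg_of_fst (by
    rw [neg_zero]; exact hξ)
  exact congrArg Prod.snd (hG.eq_zero_of_minus h1 rfl)

omit [IsManifold 𝓘(ℝ, E) ∞ M] in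
lemma finrank_cotangent [FiniteDimensional ℝ E] (x : M) :
    Module.finrank ℝ (TangentSpace 𝓘(ℝ, E) x →L[ℝ] ℝ) =
      Module.finrank ℝ (TangentSpace 𝓘(ℝ, E) x) := by
  have : Module.finrank ℝ (E →L[ℝ] ℝ) = Module.finrank ℝ E :=
    (LinearMap.toContinuousLinearMap (𝕜 := ℝ) (E := E) (F' := ℝ)).finrank_eq.symm.trans
      Subspace.dual_finrank_eq
  exact this

lemma IsGenMetric.block_isInvertible [FiniteDimensional ℝ E] {G : GEnd E M} (hG : IsGenMetric G)
    (x : M) : (G.block x).IsInvertible := by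
  have : FiniteDimensional ℝ (TangentSpace 𝓘(ℝ, E) x) := inferInstanceAs (FiniteDimensional ℝ E)
  have : FiniteDimensional ℝ (TangentSpace 𝓘(ℝ, E) x →L[ℝ] ℝ) :=
    inferInstanceAs (FiniteDimensional ℝ (E →L[ℝ] ℝ))
  have : T2Space (TangentSpace 𝓘(ℝ, E) x) := inferInstanceAs (T2Space E)
  exact ⟨(LinearEquiv.ofInjectiveOfFinrankEq _ (hG.block_injective x)
    (finrank_cotangent x)).toContinuousLinearEquiv, rfl⟩

lemma IsGenMetric.block_metric [FiniteDimensional ℝ E] {G : GEnd E M} (hG : IsGenMetric G) {x : M}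
    (X : TangentSpace 𝓘(ℝ, E) x) : G.block x (G.metric x X) = X :=
  (hG.block_isInvertible x).self_apply_inverse X

lemma IsGenMetric.metric_block [FiniteDimensional ℝ E] {G : GEnd E M} (hG : IsGenMetric G) {x : M}
    (ξ : TangentSpace 𝓘(ℝ, E) x →L[ℝ] ℝ) : G.metric x (G.block x ξ) = ξ :=
  (hG.block_isInvertible x).inverse_apply_self ξ

/-- With b = -ηA, applying η to the tangent part AX + η⁻¹ξ of G(X + ξ) gives ξ - bX. This form
removes b and makes both the exchange of C₊ with C₋ and the smoothness of C accessible. -/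
lemma IsGenMetric.swap_eq [FiniteDimensional ℝ E] {G : GEnd E M} (hG : IsGenMetric G)
    (u : GSec E M) (x : M) :
    G.swap u x = ((u x).1, (u x).2 - (2 : ℝ) • G.metric x (G x (u x)).1) := by
  have h : (G x (u x)).1 = (G x ((u x).1, 0)).1 + G.block x (u x).2 := by
    change _ = (G x ((u x).1, 0)).1 + (G x (0, (u x).2)).1
    rw [← Prod.fst_add, ← G.apply_add]
    simp
  rw [h, map_add, hG.metric_block]
  refine Prod.ext rfl ?_
  change (2 : ℝ) • -(G.metric x (G x ((u x).1, 0)).1) - (u x).2 = _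
  module

/-- The operator `C` maps `C₊` to `C₋`. -/
lemma IsGenMetric.swap_plus [FiniteDimensional ℝ E] {G : GEnd E M} (hG : IsGenMetric G)
    {u : GSec E M} {x : M} (h : G x (u x) = u x) : G x (G.swap u x) = -G.swap u x := by
  apply hG.eq_neg_of_fst
  have e : G.swap u x = u x + (0, -(2 : ℝ) • G.metric x (u x).1) := by
    rw [hG.swap_eq, h]
    refine Prod.ext (by simp) ?_
    simp only [Prod.snd_add]; module
  have hb : (G x (0, -(2 : ℝ) • G.metric x (u x).1)).1 = -(2 : ℝ) • (u x).1 := by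
    refine ((G.block x).map_smul _ _).trans ?_
    rw [hG.block_metric]
  rw [e, G.apply_add, Prod.fst_add, hb, h, Prod.fst_add]
  module

/-- The operator `C` maps `C₋` to `C₊`. -/
lemma IsGenMetric.swap_minus [FiniteDimensional ℝ E] {G : GEnd E M} (hG : IsGenMetric G)
    {u : GSec E M} {x : M} (h : G x (u x) = -u x) : G x (G.swap u x) = G.swap u x := by
  apply hG.eq_self_of_fst
  have e : G.swap u x = u x + (0, (2 : ℝ) • G.metric x (u x).1) := by
    rw [hG.swap_eq, h]
    refine Prod.ext (by simp) ?_
    simp only [Prod.snd_add, Prod.fst_neg, map_neg]; module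
  have hb : (G x (0, (2 : ℝ) • G.metric x (u x).1)).1 = (2 : ℝ) • (u x).1 := by
    refine ((G.block x).map_smul _ _).trans ?_
    rw [hG.block_metric]
  rw [e, G.apply_add, Prod.fst_add, hb, h, Prod.fst_add, Prod.fst_neg]
  module

end

/-! ### Smoothness of `η` and of the operator `C` -/

section

variable [IsManifold 𝓘(ℝ, E) ∞ M]

/-- In local trivializations η is the pointwise inverse of a smooth family of invertible operators,
and inversion is smooth. -/
lemma IsGenMetric.isSmoothCovector_metric [FiniteDimensional ℝ E] {G : GEnd E M}
    (hG : IsGenMetric G) {X : Π x : M, TangentSpace 𝓘(ℝ, E) x}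
    (hX : ContMDiff 𝓘(ℝ, E) (𝓘(ℝ, E).prod 𝓘(ℝ, E)) ∞
      (fun x : M => TotalSpace.mk' E (E := (TangentSpace 𝓘(ℝ, E) : M → Type _)) x (X x))) :
    IsSmoothCovector fun x => G.metric x (X x) := by
  intro x₀
  set e₁ := trivializationAt E (TangentSpace 𝓘(ℝ, E) : M → Type _) x₀
  set e₂ := trivializationAt (E →L[ℝ] ℝ) (fun x : M => TangentSpace 𝓘(ℝ, E) x →L[ℝ] ℝ) x₀
  set e := trivializationAt (E × (E →L[ℝ] ℝ)) ((TangentSpace 𝓘(ℝ, E) : M → Type _) ×ᵇ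
        fun x : M => TangentSpace 𝓘(ℝ, E) x →L[ℝ] ℝ) x₀
  have hGx := ((contMDiffAt_hom_bundle _).1 (hG.smooth x₀)).2
  have hXx := (contMDiffAt_section x₀).1 (hX x₀)
  rw [contMDiffAt_section]
  dsimp only at hGx
  set Γ : M → (E × (E →L[ℝ] ℝ)) →L[ℝ] (E × (E →L[ℝ] ℝ)) := fun z => _
  change ContMDiffAt _ _ _ Γ x₀ at hGx
  set b : M → (E →L[ℝ] ℝ) →L[ℝ] E := fun z =>
    (ContinuousLinearMap.fst ℝ _ _).comp ((Γ z).comp (ContinuousLinearMap.inr ℝ _ _))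
  have hbs : ContMDiffAt 𝓘(ℝ, E) 𝓘(ℝ, (E →L[ℝ] ℝ) →L[ℝ] E) ∞ b x₀ :=
    contMDiffAt_const.clm_comp (hGx.clm_comp contMDiffAt_const)
  have hbase : e.baseSet ∈ nhds x₀ := e.open_baseSet.mem_nhds (mem_baseSet_trivializationAt _ _ x₀)
  -- The trivialization `e` is the product of `e₁` and `e₂`, so passing to coordinates respects the
  -- blocks of G.
  have key : ∀ z (hz : z ∈ e.baseSet), b z =
      ((e₁.continuousLinearEquivAt ℝ z hz.1 : _ →L[ℝ] E).comp (G.block z)).comp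
        ((e₂.continuousLinearEquivAt ℝ z hz.2).symm : _ →L[ℝ] _) := by
    intro z hz
    have h1 : Γ z = (e.continuousLinearEquivAt ℝ z hz : _ →L[ℝ] _).comp
        ((G z).comp ((e.continuousLinearEquivAt ℝ z hz).symm : _ →L[ℝ] _)) :=
      ContinuousLinearMap.inCoordinates_eq hz hz
    ext τ
    obtain ⟨τ', rfl⟩ := (e₂.continuousLinearEquivAt ℝ z hz.2).surjective τ
    have h2 : ((0 : E), e₂.continuousLinearEquivAt ℝ z hz.2 τ') =
        e.continuousLinearEquivAt ℝ z hz (0, τ') :=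
      Prod.ext (map_zero (e₁.continuousLinearEquivAt ℝ z hz.1)).symm rfl
    change (Γ z (0, e₂.continuousLinearEquivAt ℝ z hz.2 τ')).1 =
      e₁.continuousLinearEquivAt ℝ z hz.1 (G.block z ((e₂.continuousLinearEquivAt ℝ z hz.2).symm
        (e₂.continuousLinearEquivAt ℝ z hz.2 τ')))
    rw [h1, h2, ContinuousLinearEquiv.symm_apply_apply]
    change (e.continuousLinearEquivAt ℝ z hz (G z ((e.continuousLinearEquivAt ℝ z hz).symm
      (e.continuousLinearEquivAt ℝ z hz (0, τ'))))).1 = _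
    rw [ContinuousLinearEquiv.symm_apply_apply]
    rfl
  have hinv : ∀ z ∈ e.baseSet, (b z).IsInvertible := by
    intro z hz
    rw [key z hz]
    exact (ContinuousLinearMap.isInvertible_equiv.comp (hG.block_isInvertible z)).comp
      ContinuousLinearMap.isInvertible_equiv
  have hval : ∀ z ∈ e.baseSet,
      (e₂ ⟨z, G.metric z (X z)⟩).2 = (b z).inverse (e₁ ⟨z, X z⟩).2 := by
    intro z hz
    have h3 : b z (e₂.continuousLinearEquivAt ℝ z hz.2 (G.metric z (X z))) =
        e₁.continuousLinearEquivAt ℝ z hz.1 (X z) := by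
      rw [key z hz]
      change e₁.continuousLinearEquivAt ℝ z hz.1 (G.block z
        ((e₂.continuousLinearEquivAt ℝ z hz.2).symm (e₂.continuousLinearEquivAt ℝ z hz.2 _))) = _
      rw [ContinuousLinearEquiv.symm_apply_apply, hG.block_metric]
    change e₂.continuousLinearEquivAt ℝ z hz.2 _ =
      (b z).inverse (e₁.continuousLinearEquivAt ℝ z hz.1 (X z))
    rw [← h3, (hinv z hz).inverse_apply_self]
  have hsm : ContMDiffAt 𝓘(ℝ, E) 𝓘(ℝ, E →L[ℝ] (E →L[ℝ] ℝ)) ∞ (fun z => (b z).inverse) x₀ := by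
    have := FiniteDimensional.complete ℝ E
    exact ((hinv x₀ (mem_baseSet_trivializationAt _ _ x₀)).contDiffAt_map_inverse).comp_contMDiffAt
      hbs
  exact (hsm.clm_apply hXx).congr_of_eventuallyEq (Filter.eventually_of_mem hbase hval)

/-- The operator `C` preserves smoothness. -/
lemma IsGenMetric.isSmooth_swap [FiniteDimensional ℝ E] {G : GEnd E M} (hG : IsGenMetric G)
    {u : GSec E M} (hu : u.IsSmooth) : (G.swap u).IsSmooth := by
  have h1 := (GSec.isSmooth_iff _).1 hu
  have h2 := hG.isSmoothCovector_metric ((GSec.isSmooth_iff _).1 (hG.smooth.act hu)).1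
  rw [GSec.isSmooth_iff]
  have e := funext (hG.swap_eq u)
  refine ⟨h1.1, ?_⟩
  rw [e]
  exact ContMDiff.sub_section h1.2 (ContMDiff.const_smul_section h2)

end

/-! ### Eigenbundle projections and brackets of commuting integrable structures -/

section

variable [IsManifold 𝓘(ℝ, E) ∞ M]

lemma GSec.isSmooth_zero : (0 : GSec E M).IsSmooth := contMDiff_zeroSection _ _

lemma dorfman_zero_right [CompleteSpace E] (H : Form E M 3) {u : GSec E M} (hu : u.IsSmooth) :
    dorfman H u 0 = 0 := by
  simpa using dorfman_add_right H hu GSec.isSmooth_zero GSec.isSmooth_zero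

lemma dorfman_neg_right [CompleteSpace E] (H : Form E M 3) {u v : GSec E M} (hu : u.IsSmooth)
    (hv : v.IsSmooth) : dorfman H u (-v) = -dorfman H u v := by
  refine eq_neg_of_add_eq_zero_left ?_
  rw [← dorfman_add_right H hu hv.neg hv, neg_add_cancel, dorfman_zero_right H hu]

omit [IsManifold 𝓘(ℝ, E) ∞ M] in
lemma GEnd.projPlus_add_projMinus (A : GEnd E M) (u : GSec E M) :
    A.projPlus u + A.projMinus u = u := by
  funext x
  simp only [projPlus, projMinus, Pi.add_apply]
  module

omit [IsManifold 𝓘(ℝ, E) ∞ M] in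
lemma GEnd.projPlus_sub_projMinus (A : GEnd E M) (u : GSec E M) :
    A.projPlus u - A.projMinus u = A.act u := by
  funext x
  simp only [projPlus, projMinus, Pi.sub_apply, act]
  module

omit [IsManifold 𝓘(ℝ, E) ∞ M] in
lemma GEnd.projPlus_add (A : GEnd E M) (u v : GSec E M) :
    A.projPlus (u + v) = A.projPlus u + A.projPlus v := by
  funext x
  simp only [projPlus, Pi.add_apply, A.apply_add]
  module

omit [IsManifold 𝓘(ℝ, E) ∞ M] in
lemma GEnd.projMinus_add (A : GEnd E M) (u v : GSec E M) :
    A.projMinus (u + v) = A.projMinus u + A.projMinus v := by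
  funext x
  simp only [projMinus, Pi.add_apply, A.apply_add]
  module

omit [IsManifold 𝓘(ℝ, E) ∞ M] in
lemma GEnd.swap_add (A : GEnd E M) (u v : GSec E M) :
    A.swap (u + v) = A.swap u + A.swap v := by
  funext x
  refine Prod.ext rfl ?_
  simp only [swap, Pi.add_apply, Prod.fst_add, Prod.snd_add, map_add]
  module

omit [IsManifold 𝓘(ℝ, E) ∞ M] in
lemma GEnd.projPlus_neg (A : GEnd E M) (u : GSec E M) : (-A).projPlus u = A.projMinus u := by
  funext x
  change (1 / 2 : ℝ) • (u x + -A x (u x)) = (1 / 2 : ℝ) • (u x - A x (u x))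
  rw [sub_eq_add_neg]

omit [IsManifold 𝓘(ℝ, E) ∞ M] in
lemma GEnd.projMinus_neg (A : GEnd E M) (u : GSec E M) : (-A).projMinus u = A.projPlus u := by
  funext x
  change (1 / 2 : ℝ) • (u x - -A x (u x)) = (1 / 2 : ℝ) • (u x + A x (u x))
  rw [sub_neg_eq_add]

set_option synthInstance.maxHeartbeats 400000 in
lemma GEnd.IsSmooth.neg {A : GEnd E M} (hA : A.IsSmooth) : (-A).IsSmooth :=
  ContMDiff.neg_section hA

lemma GEnd.IsSmooth.projPlus {A : GEnd E M} (hA : A.IsSmooth) {u : GSec E M} (hu : u.IsSmooth) :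
    (A.projPlus u).IsSmooth :=
  (hu.add (hA.act hu)).const_smul (1 / 2)

lemma GEnd.IsSmooth.projMinus {A : GEnd E M} (hA : A.IsSmooth) {u : GSec E M} (hu : u.IsSmooth) :
    (A.projMinus u).IsSmooth :=
  (hu.sub (hA.act hu)).const_smul (1 / 2)

omit [IsManifold 𝓘(ℝ, E) ∞ M] in
lemma GEnd.apply_projPlus {A : GEnd E M} (hA : ∀ x (w : GTan (E := E) x), A x (A x w) = w)
    (u : GSec E M) (x : M) : A x (A.projPlus u x) = A.projPlus u x := by
  simp only [projPlus, A.apply_smul, A.apply_add, hA, add_comm]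

omit [IsManifold 𝓘(ℝ, E) ∞ M] in
lemma GEnd.apply_projMinus {A : GEnd E M} (hA : ∀ x (w : GTan (E := E) x), A x (A x w) = w)
    (u : GSec E M) (x : M) : A x (A.projMinus u x) = -A.projMinus u x := by
  simp only [projMinus, A.apply_smul, A.apply_sub, hA]
  module

omit [IsManifold 𝓘(ℝ, E) ∞ M] in
lemma GEnd.projPlus_eq_self {A : GEnd E M} {u : GSec E M} (hu : ∀ x, A x (u x) = u x) :
    A.projPlus u = u := by
  funext x
  simp only [projPlus, hu]
  module

omit [IsManifold 𝓘(ℝ, E) ∞ M] in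
lemma GEnd.projMinus_eq_zero {A : GEnd E M} {u : GSec E M} (hu : ∀ x, A x (u x) = u x) :
    A.projMinus u = 0 := by
  funext x
  simp only [projMinus, hu, sub_self, smul_zero, Pi.zero_apply]

omit [IsManifold 𝓘(ℝ, E) ∞ M] in
lemma GEnd.apply_comm {A B : GEnd E M} (h : A.comp B = B.comp A) {x : M} (w : GTan (E := E) x) :
    A x (B x w) = B x (A x w) := congrArg (fun C : GEnd E M => C x w) h

/-- Passing to -K exchanges the eigenbundles, so later arguments need only treat the
`+1`-eigenbundle. -/
lemma IsAlmostGpC.neg {K : GEnd E M} (hK : IsAlmostGpC K) : IsAlmostGpC (-K) where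
  smooth := hK.smooth.neg
  sq x w := by
    change -K x (-K x w) = w
    rw [K.apply_neg, hK.sq, neg_neg]
  anti x w z := by
    change pairing (-K x w) (-K x z) = _
    rw [pairing_neg_left, pairing_neg_right, neg_neg, hK.anti]

/-- The `+1`-eigenbundle of a para-complex structure is isotropic. -/
lemma IsAlmostGpC.isotropic {K : GEnd E M} (hK : IsAlmostGpC K) {x : M} {w z : GTan (E := E) x}
    (hw : K x w = w) (hz : K x z = z) : pairing w z = 0 := by
  have := hK.anti x w z
  rw [hw, hz] at this
  linarith

/-- The `+1`-eigenbundle of a para-complex structure contains its orthogonal complement. -/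
lemma IsAlmostGpC.eq_of_pairing_eq_zero {K : GEnd E M} (hK : IsAlmostGpC K) {x : M}
    {w : GTan (E := E) x} (h : ∀ z : GTan (E := E) x, K x z = z → pairing w z = 0) :
    K x w = w := by
  refine (sub_eq_zero.1 (eq_zero_of_pairing_eq_zero fun y => ?_)).symm
  -- Testing against y + Ky, which lies in the `+1`-eigenbundle, gives ⟨w, y⟩ + ⟨w, Ky⟩ = 0, while
  -- ⟨w, Ky⟩ = -⟨Kw, y⟩.
  have h1 := h (y + K x y) (by rw [K.apply_add, hK.sq, add_comm])
  have h2 := hK.anti x w (K x y)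
  rw [hK.sq] at h2
  rw [sub_eq_add_neg, pairing_add_left, pairing_neg_left]
  rw [pairing_add_right] at h1
  linarith

lemma IsCourantIntegrable.neg {H : Form E M 3} {K : GEnd E M} (h : IsCourantIntegrable H K) :
    IsCourantIntegrable H (-K) where
  plus u v hu hv hu' hv' x :=
    neg_eq_iff_eq_neg.2 (h.minus u v hu hv (fun y => neg_eq_iff_eq_neg.1 (hu' y))
      (fun y => neg_eq_iff_eq_neg.1 (hv' y)) x)
  minus u v hu hv hu' hv' x :=
    congrArg Neg.neg (h.plus u v hu hv (fun y => neg_injective (hu' y))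
      (fun y => neg_injective (hv' y)) x)

/-- If `K` and `L` are commuting integrable para-complex structures, then bracketing with a section
of the `-1`-eigenbundle of `K L` and projecting to the `+1`-eigenbundle commutes with `K`. -/
lemma projPlus_dorfman_act [CompleteSpace E] {H : Form E M 3} {K L : GEnd E M}
    (hK : IsAlmostGpC K) (hcomm : K.comp L = L.comp K)
    (iK : IsCourantIntegrable H K) (iL : IsCourantIntegrable H L) {a v : GSec E M}
    (ha : a.IsSmooth) (hv : v.IsSmooth) (ha' : ∀ x, K x (L x (a x)) = -a x)
    (hv' : ∀ x, K x (L x (v x)) = v x) :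
    (K.comp L).projPlus (dorfman H a (K.act v)) =
      K.act ((K.comp L).projPlus (dorfman H a v)) := by
  have hLa (x : M) : L x (a x) = -K x (a x) := by
    rw [← K.apply_neg, ← ha', hK.sq]
  have hLv (x : M) : L x (v x) = K x (v x) := by
    conv_rhs => rw [← hv', hK.sq]
  -- The joint types (K, L) are (+,-) for `a₁`, (-,+) for `a₂`, (+,+) for `v₁` and (-,-) for `v₂`.
  set a₁ := K.projPlus a with ha₁
  set a₂ := K.projMinus a with ha₂
  set v₁ := K.projPlus v with hv₁
  set v₂ := K.projMinus v with hv₂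
  have sa₁ : a₁.IsSmooth := hK.smooth.projPlus ha
  have sa₂ : a₂.IsSmooth := hK.smooth.projMinus ha
  have sv₁ : v₁.IsSmooth := hK.smooth.projPlus hv
  have sv₂ : v₂.IsSmooth := hK.smooth.projMinus hv
  have Ka₁ : ∀ x, K x (a₁ x) = a₁ x := GEnd.apply_projPlus hK.sq a
  have Ka₂ : ∀ x, K x (a₂ x) = -a₂ x := GEnd.apply_projMinus hK.sq a
  have Kv₁ : ∀ x, K x (v₁ x) = v₁ x := GEnd.apply_projPlus hK.sq v
  have Kv₂ : ∀ x, K x (v₂ x) = -v₂ x := GEnd.apply_projMinus hK.sq v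
  have La₁ (x : M) : L x (a₁ x) = -a₁ x := by
    simp only [ha₁, GEnd.projPlus, L.apply_smul, L.apply_add, ← GEnd.apply_comm hcomm, hLa,
      K.apply_neg, hK.sq]
    module
  have La₂ (x : M) : L x (a₂ x) = a₂ x := by
    simp only [ha₂, GEnd.projMinus, L.apply_smul, L.apply_sub, ← GEnd.apply_comm hcomm, hLa,
      K.apply_neg, hK.sq]
    module
  have Lv₁ (x : M) : L x (v₁ x) = v₁ x := by
    simp only [hv₁, GEnd.projPlus, L.apply_smul, L.apply_add, ← GEnd.apply_comm hcomm, hLv, hK.sq]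
    module
  have Lv₂ (x : M) : L x (v₂ x) = -v₂ x := by
    simp only [hv₂, GEnd.projMinus, L.apply_smul, L.apply_sub, ← GEnd.apply_comm hcomm, hLv, hK.sq]
    module
  have ea : a = a₁ + a₂ := (K.projPlus_add_projMinus a).symm
  have ev : v = v₁ + v₂ := (K.projPlus_add_projMinus v).symm
  have eKv : K.act v = v₁ + -v₂ := by rw [← sub_eq_add_neg]; exact (K.projPlus_sub_projMinus v).symm
  rw [eKv, ev, dorfman_add_right H ha sv₁ sv₂, dorfman_add_right H ha sv₁ sv₂.neg,
    dorfman_neg_right H ha sv₂, ea, dorfman_add_left H sa₁ sa₂ sv₁, dorfman_add_left H sa₁ sa₂ sv₂]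
  funext x
  -- Each pair shares one eigenvalue: that of K for (a₁, v₁) and (a₂, v₂), that of L for the other
  -- two. After projection to the `+1`-eigenbundle of KL, where K = L, it is in all cases the
  -- K-eigenvalue of the `v` factor.
  have h11 := iK.plus a₁ v₁ sa₁ sv₁ Ka₁ Kv₁ x
  have h21 := iL.plus a₂ v₁ sa₂ sv₁ La₂ Lv₁ x
  have h12 := iL.minus a₁ v₂ sa₁ sv₂ La₁ Lv₂ x
  have h22 := iK.minus a₂ v₂ sa₂ sv₂ Ka₂ Kv₂ x
  have c (w : GTan (E := E) x) : K x (L x w) = L x (K x w) := GEnd.apply_comm hcomm w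
  simp only [GEnd.projPlus, GEnd.act, GEnd.comp, ContinuousLinearMap.comp_apply, Pi.add_apply,
    Pi.neg_apply, K.apply_smul, K.apply_add, L.apply_add, K.apply_neg, L.apply_neg, h21, h12, h11,
    h22, hK.sq, c]
  module

end

/-! ### The generalized Bismut connection and the type of its torsion -/

section

variable [IsManifold 𝓘(ℝ, E) ∞ M]

lemma bismut_add_left [FiniteDimensional ℝ E] (H : Form E M 3) {G : GEnd E M}
    (hG : IsGenMetric G) {u u' v : GSec E M} (hu : u.IsSmooth) (hu' : u'.IsSmooth)
    (hv : v.IsSmooth) : bismut H G (u + u') v = bismut H G u v + bismut H G u' v := by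
  have := FiniteDimensional.complete ℝ E
  have p {w : GSec E M} (hw : w.IsSmooth) := hG.smooth.projPlus hw
  have m {w : GSec E M} (hw : w.IsSmooth) := hG.smooth.projMinus hw
  simp only [bismut, GEnd.projPlus_add, GEnd.projMinus_add, GEnd.swap_add]
  rw [dorfman_add_left H (m hu) (m hu') (p hv), dorfman_add_left H (p hu) (p hu') (m hv),
    dorfman_add_left H (hG.isSmooth_swap (m hu)) (hG.isSmooth_swap (m hu')) (m hv),
    dorfman_add_left H (hG.isSmooth_swap (p hu)) (hG.isSmooth_swap (p hu')) (p hv)]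
  simp only [GEnd.projPlus_add, GEnd.projMinus_add]
  abel

lemma bismut_add_right [FiniteDimensional ℝ E] (H : Form E M 3) {G : GEnd E M}
    (hG : IsGenMetric G) {u v v' : GSec E M} (hu : u.IsSmooth) (hv : v.IsSmooth)
    (hv' : v'.IsSmooth) : bismut H G u (v + v') = bismut H G u v + bismut H G u v' := by
  have := FiniteDimensional.complete ℝ E
  have p {w : GSec E M} (hw : w.IsSmooth) := hG.smooth.projPlus hw
  have m {w : GSec E M} (hw : w.IsSmooth) := hG.smooth.projMinus hw
  simp only [bismut, GEnd.projPlus_add, GEnd.projMinus_add]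
  rw [dorfman_add_right H (m hu) (p hv) (p hv'), dorfman_add_right H (p hu) (m hv) (m hv'),
    dorfman_add_right H (hG.isSmooth_swap (m hu)) (m hv) (m hv'),
    dorfman_add_right H (hG.isSmooth_swap (p hu)) (p hv) (p hv')]
  simp only [GEnd.projPlus_add, GEnd.projMinus_add]
  abel

/-- The generalized Bismut connection of `K L` preserves `K` when both `K` and `L` are
integrable. -/
lemma isParallel_bismut [FiniteDimensional ℝ E] {H : Form E M 3} {K L : GEnd E M}
    (hK : IsAlmostGpC K) (hcomm : K.comp L = L.comp K) (hG : IsGenMetric (K.comp L))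
    (iK : IsCourantIntegrable H K) (iL : IsCourantIntegrable H L) :
    IsParallel (bismut H (K.comp L)) K := by
  have := FiniteDimensional.complete ℝ E
  intro u v hu hv
  have c {x : M} (w : GTan (E := E) x) : K x (L x w) = L x (K x w) := GEnd.apply_comm hcomm w
  set G := K.comp L with hGdef
  -- Replacing L by -L replaces G by -G, so the statement about [C₋, C₊]₊ also yields the one about
  -- [C₊, C₋]₋.
  have hcomm' : K.comp (-L) = (-L).comp K := by
    funext x
    refine ContinuousLinearMap.ext fun w => ?_
    change K x (-L x w) = -L x (K x w)
    rw [K.apply_neg, c]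
  have hneg : K.comp (-L) = -G := by
    funext x
    refine ContinuousLinearMap.ext fun w => ?_
    exact K.apply_neg x (L x w)
  have p {w : GSec E M} (hw : w.IsSmooth) := hG.smooth.projPlus hw
  have m {w : GSec E M} (hw : w.IsSmooth) := hG.smooth.projMinus hw
  have ep (w : GSec E M) (x : M) : G x (G.projPlus w x) = G.projPlus w x :=
    GEnd.apply_projPlus hG.sq w x
  have em (w : GSec E M) (x : M) : G x (G.projMinus w x) = -G.projMinus w x :=
    GEnd.apply_projMinus hG.sq w x
  have plus {a w : GSec E M} (ha : a.IsSmooth) (hw : w.IsSmooth) (ha' : ∀ x, G x (a x) = -a x)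
      (hw' : ∀ x, G x (w x) = w x) :
      G.projPlus (dorfman H a (K.act w)) = K.act (G.projPlus (dorfman H a w)) :=
    projPlus_dorfman_act hK hcomm iK iL ha hw ha' hw'
  have minus {a w : GSec E M} (ha : a.IsSmooth) (hw : w.IsSmooth) (ha' : ∀ x, G x (a x) = a x)
      (hw' : ∀ x, G x (w x) = -w x) :
      G.projMinus (dorfman H a (K.act w)) = K.act (G.projMinus (dorfman H a w)) := by
    rw [← GEnd.projPlus_neg, ← GEnd.projPlus_neg, ← hneg]
    refine projPlus_dorfman_act hK hcomm' iK iL.neg ha hw (fun x => ?_) (fun x => ?_)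
    · exact (K.apply_neg x _).trans (congrArg Neg.neg (ha' x))
    · exact (K.apply_neg x _).trans (neg_eq_iff_eq_neg.2 (hw' x))
  have kp : G.projPlus (K.act v) = K.act (G.projPlus v) := by
    funext x
    simp only [GEnd.projPlus, GEnd.act, hGdef, GEnd.comp, ContinuousLinearMap.comp_apply,
      K.apply_smul, K.apply_add, c]
  have km : G.projMinus (K.act v) = K.act (G.projMinus v) := by
    funext x
    simp only [GEnd.projMinus, GEnd.act, hGdef, GEnd.comp, ContinuousLinearMap.comp_apply,
      K.apply_smul, K.apply_sub, c]
  have add (w z : GSec E M) : K.act w + K.act z = K.act (w + z) :=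
    funext fun x => (K.apply_add x _ _).symm
  simp only [bismut, kp, km]
  -- Since C exchanges C₊ and C₋, the two arguments of the bracket lie in opposite eigenbundles of G
  -- in the terms with C as well.
  rw [plus (m hu) (p hv) (em u) (ep v), minus (p hu) (m hv) (ep u) (em v),
    minus (hG.isSmooth_swap (m hu)) (m hv) (fun x => hG.swap_minus (em u x)) (em v),
    plus (hG.isSmooth_swap (p hu)) (p hv) (fun x => hG.swap_plus (ep u x)) (ep v)]
  simp only [add]

lemma IsParallel.neg {D : GSec E M → GSec E M → GSec E M} {K : GEnd E M} (h : IsParallel D K)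
    (hD : ∀ u v : GSec E M, u.IsSmooth → v.IsSmooth → D u (-v) = -D u v) (hK : K.IsSmooth) :
    IsParallel D (-K) := by
  intro u v hu hv
  change D u (-(K.act v)) = -(K.act (D u v))
  rw [hD u _ hu (hK.act hv), h u v hu hv]

lemma bismut_zero_right [FiniteDimensional ℝ E] (H : Form E M 3) {G : GEnd E M}
    (hG : IsGenMetric G) {u : GSec E M} (hu : u.IsSmooth) : bismut H G u 0 = 0 := by
  simpa using bismut_add_right H hG hu GSec.isSmooth_zero GSec.isSmooth_zero

lemma bismut_neg_right [FiniteDimensional ℝ E] (H : Form E M 3) {G : GEnd E M}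
    (hG : IsGenMetric G) {u v : GSec E M} (hu : u.IsSmooth) (hv : v.IsSmooth) :
    bismut H G u (-v) = -bismut H G u v := by
  refine eq_neg_of_add_eq_zero_left ?_
  rw [← bismut_add_right H hG hu hv.neg hv, neg_add_cancel, bismut_zero_right H hG hu]

section Torsion

variable [FiniteDimensional ℝ E] (H : Form E M 3) {G : GEnd E M}

/-- Additivity in each slot suffices for the type decomposition, which only splits sections into
their two projections; linearity over functions plays no role. -/
lemma genTorsion_add₁ (hG : IsGenMetric G) {u u' v w : GSec E M} (hu : u.IsSmooth)
    (hu' : u'.IsSmooth) (hv : v.IsSmooth) (hw : w.IsSmooth) (x : M) :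
    genTorsion H (bismut H G) (u + u') v w x =
      genTorsion H (bismut H G) u v w x + genTorsion H (bismut H G) u' v w x := by
  have := FiniteDimensional.complete ℝ E
  simp only [genTorsion]
  rw [bismut_add_left H hG hu hu' hv, bismut_add_right H hG hv hu hu',
    bismut_add_right H hG hw hu hu', dorfman_add_left H hu hu' hv]
  simp only [Pi.add_apply, sub_eq_add_neg, neg_add, pairing_add_left, pairing_neg_left]
  ring

lemma genTorsion_add₂ (hG : IsGenMetric G) {u v v' w : GSec E M} (hu : u.IsSmooth)
    (hv : v.IsSmooth) (hv' : v'.IsSmooth) (x : M) :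
    genTorsion H (bismut H G) u (v + v') w x =
      genTorsion H (bismut H G) u v w x + genTorsion H (bismut H G) u v' w x := by
  have := FiniteDimensional.complete ℝ E
  simp only [genTorsion]
  rw [bismut_add_left H hG hv hv' hu, bismut_add_right H hG hu hv hv',
    dorfman_add_right H hu hv hv']
  simp only [Pi.add_apply, sub_eq_add_neg, neg_add, pairing_add_left, pairing_neg_left,
    pairing_add_right]
  ring

lemma genTorsion_add₃ (hG : IsGenMetric G) {u v w w' : GSec E M} (hu : u.IsSmooth)
    (hw : w.IsSmooth) (hw' : w'.IsSmooth) (x : M) :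
    genTorsion H (bismut H G) u v (w + w') x =
      genTorsion H (bismut H G) u v w x + genTorsion H (bismut H G) u v w' x := by
  simp only [genTorsion]
  rw [bismut_add_left H hG hw hw' hu]
  simp only [Pi.add_apply, pairing_add_left, pairing_add_right]
  ring

omit [FiniteDimensional ℝ E] in
/-- The generalized torsion of a connection preserving an integrable para-complex structure
vanishes on its `+1`-eigenbundle. -/
lemma genTorsion_eq_zero {D : GSec E M → GSec E M → GSec E M} {K : GEnd E M}
    (hK : IsAlmostGpC K) (hD : IsParallel D K) (iK : IsCourantIntegrable H K) {u v w : GSec E M}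
    (hu : u.IsSmooth) (hv : v.IsSmooth) (hw : w.IsSmooth) (hu' : ∀ x, K x (u x) = u x)
    (hv' : ∀ x, K x (v x) = v x) (hw' : ∀ x, K x (w x) = w x) (x : M) :
    genTorsion H D u v w x = 0 := by
  have pres {a b : GSec E M} (ha : a.IsSmooth) (hb : b.IsSmooth) (hb' : ∀ x, K x (b x) = b x) :
      K x (D a b x) = D a b x := by
    have h := hD a b ha hb
    rw [show K.act b = b from funext hb'] at h
    exact (congrFun h x).symm
  have h1 : K x (D u v x - D v u x - dorfman H u v x) = D u v x - D v u x - dorfman H u v x := by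
    rw [K.apply_sub, K.apply_sub, pres hu hv hv', pres hv hu hu', iK.plus u v hu hv hu' hv']
  rw [genTorsion, hK.isotropic h1 (hw' x), hK.isotropic (pres hw hu hu') (hv' x), add_zero]

/-- If the Bismut connection preserves an integrable `K`, then its torsion is of type
`(2,1) + (1,2)` with respect to `K`. -/
lemma isOfType_bismut (hG : IsGenMetric G) {K : GEnd E M} (hK : IsAlmostGpC K)
    (hD : IsParallel (bismut H G) K) (iK : IsCourantIntegrable H K) :
    IsOfType21Add12 (genTorsion H (bismut H G)) K := by
  intro u v w hu hv hw x
  have p {w : GSec E M} (hw : w.IsSmooth) := hK.smooth.projPlus hw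
  have m {w : GSec E M} (hw : w.IsSmooth) := hK.smooth.projMinus hw
  have hppp : genTorsion H (bismut H G) (K.projPlus u) (K.projPlus v) (K.projPlus w) x = 0 :=
    genTorsion_eq_zero H hK hD iK (p hu) (p hv) (p hw) (GEnd.apply_projPlus hK.sq u)
      (GEnd.apply_projPlus hK.sq v) (GEnd.apply_projPlus hK.sq w) x
  have hmmm : genTorsion H (bismut H G) (K.projMinus u) (K.projMinus v) (K.projMinus w) x = 0 := by
    have hD' := hD.neg (fun u v hu hv => bismut_neg_right H hG hu hv) hK.smooth
    have e (w : GSec E M) (x : M) : (-K) x (K.projMinus w x) = K.projMinus w x := by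
      rw [← GEnd.projPlus_neg]
      exact GEnd.apply_projPlus hK.neg.sq w x
    exact genTorsion_eq_zero H hK.neg hD' iK.neg (m hu) (m hv) (m hw) (e u) (e v) (e w) x
  -- Of the eight components, the pure ones vanish and the six mixed ones are the (2,1) and (1,2)
  -- parts.
  conv_lhs => rw [← K.projPlus_add_projMinus u, ← K.projPlus_add_projMinus v,
    ← K.projPlus_add_projMinus w]
  rw [genTorsion_add₁ H hG (p hu) (m hu) ((p hv).add (m hv)) ((p hw).add (m hw)),
    genTorsion_add₂ H hG (p hu) (p hv) (m hv), genTorsion_add₂ H hG (m hu) (p hv) (m hv),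
    genTorsion_add₃ H hG (p hu) (p hw) (m hw), genTorsion_add₃ H hG (p hu) (p hw) (m hw),
    genTorsion_add₃ H hG (m hu) (p hw) (m hw), genTorsion_add₃ H hG (m hu) (p hw) (m hw),
    hppp, hmmm, component21, component12]
  ring

omit [FiniteDimensional ℝ E] in
lemma IsOfType21Add12.neg {T : GSec E M → GSec E M → GSec E M → M → ℝ} {K : GEnd E M}
    (h : IsOfType21Add12 T K) : IsOfType21Add12 T (-K) := by
  intro u v w hu hv hw x
  rw [h u v w hu hv hw x]
  simp only [component21, component12, GEnd.projPlus_neg, GEnd.projMinus_neg]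
  ring

/-- If the Bismut connection preserves `K` and its torsion has no `(3,0)` component, then the
`+1`-eigenbundle of `K` is involutive. -/
lemma involutive_of_isOfType [T2Space M] (hG : IsGenMetric G) {K : GEnd E M} (hK : IsAlmostGpC K)
    (hD : IsParallel (bismut H G) K) (hT : IsOfType21Add12 (genTorsion H (bismut H G)) K)
    {u v : GSec E M} (hu : u.IsSmooth) (hv : v.IsSmooth) (hu' : ∀ x, K x (u x) = u x)
    (hv' : ∀ x, K x (v x) = v x) (x : M) : K x (dorfman H u v x) = dorfman H u v x := by
  have := FiniteDimensional.complete ℝ E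
  have pres {a b : GSec E M} (ha : a.IsSmooth) (hb : b.IsSmooth) (hb' : ∀ x, K x (b x) = b x) :
      K x (bismut H G a b x) = bismut H G a b x := by
    have h := hD a b ha hb
    rw [show K.act b = b from funext hb'] at h
    exact (congrFun h x).symm
  refine hK.eq_of_pairing_eq_zero fun z hz => ?_
  obtain ⟨w₀, hw₀, hw₀x⟩ := GSec.exists_isSmooth_eq (M := M) x z
  set w := K.projPlus w₀
  have hw : w.IsSmooth := hK.smooth.projPlus hw₀
  have hw' : ∀ x, K x (w x) = w x := GEnd.apply_projPlus hK.sq w₀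
  have hwx : w x = z := by
    simp only [w, GEnd.projPlus, hw₀x, hz]
    module
  have h := hT u v w hu hv hw x
  have z₁ {a b : GSec E M} (ha : a.IsSmooth) (hb : b.IsSmooth) :
      genTorsion H (bismut H G) 0 a b x = 0 := by
    simpa using genTorsion_add₁ H hG GSec.isSmooth_zero GSec.isSmooth_zero ha hb x
  have z₂ {a b : GSec E M} (ha : a.IsSmooth) : genTorsion H (bismut H G) a 0 b x = 0 := by
    simpa using genTorsion_add₂ H hG (w := b) ha GSec.isSmooth_zero GSec.isSmooth_zero x
  have z₃ {a b : GSec E M} (ha : a.IsSmooth) : genTorsion H (bismut H G) a b 0 x = 0 := by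
    simpa using genTorsion_add₃ H hG (v := b) ha GSec.isSmooth_zero GSec.isSmooth_zero x
  -- All three sections lie in the `+1`-eigenbundle, so every mixed component has a zero argument
  -- and `h` becomes T(u, v, w) = 0.
  simp only [component21, component12, GEnd.projPlus_eq_self hu', GEnd.projPlus_eq_self hv',
    GEnd.projPlus_eq_self hw', GEnd.projMinus_eq_zero hu', GEnd.projMinus_eq_zero hv',
    GEnd.projMinus_eq_zero hw', z₃ hu, z₂ hu, z₁ hv hw, z₁ GSec.isSmooth_zero hw,
    z₁ hv GSec.isSmooth_zero, add_zero] at h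
  -- Isotropy removes every term containing D, leaving -⟨[u, v], w⟩ = 0.
  rw [genTorsion, hK.isotropic (pres hw hu hu') (hv' x), add_zero, sub_eq_add_neg,
    pairing_add_left, hK.isotropic _ (hw' x), pairing_neg_left, hwx] at h
  · linarith
  · rw [K.apply_sub, pres hu hv hv', pres hv hu hu']

lemma isCourantIntegrable_of_isOfType [T2Space M] (hG : IsGenMetric G) {K : GEnd E M}
    (hK : IsAlmostGpC K) (hD : IsParallel (bismut H G) K)
    (hT : IsOfType21Add12 (genTorsion H (bismut H G)) K) : IsCourantIntegrable H K where
  plus _ _ hu hv hu' hv' := involutive_of_isOfType H hG hK hD hT hu hv hu' hv'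
  minus _ _ hu hv hu' hv' x := by
    have hD' := hD.neg (fun u v hu hv => bismut_neg_right H hG hu hv) hK.smooth
    exact neg_eq_iff_eq_neg.1 (involutive_of_isOfType H hG hK.neg hD' hT.neg hu hv
      (fun y => neg_eq_iff_eq_neg.2 (hu' y)) (fun y => neg_eq_iff_eq_neg.2 (hv' y)) x)

end Torsion

end

/-! ### Split signature -/

section

/-- A symmetric non-degenerate bilinear form for which a para-complex structure is an anti-isometry
is of split signature. -/
lemma exists_isCompl_pos_neg {V : Type*} [AddCommGroup V] [Module ℝ V] [FiniteDimensional ℝ V]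
    (B : V →ₗ[ℝ] V →ₗ[ℝ] ℝ) (hsymm : ∀ v w, B v w = B w v)
    (hnd : ∀ v, (∀ w, B v w = 0) → v = 0) (κ : V → V) (hadd : ∀ v w, κ (v + w) = κ v + κ w)
    (hsmul : ∀ (c : ℝ) v, κ (c • v) = c • κ v) (hsq : ∀ v, κ (κ v) = v)
    (hanti : ∀ v w, B (κ v) (κ w) = -B v w) :
    ∃ P N : Submodule ℝ V, IsCompl P N ∧ Module.finrank ℝ P = Module.finrank ℝ N ∧
      (∀ v ∈ P, v ≠ 0 → 0 < B v v) ∧ (∀ v ∈ N, v ≠ 0 → B v v < 0) := by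
  -- The eigenspaces of κ for ±1 are isotropic and span V, so B puts them in perfect duality. The
  -- graphs of φ and -φ, for a suitable isomorphism φ between them, are then the definite subspaces.
  let L (s : ℝ) : Submodule ℝ V :=
    { carrier := {v | κ v = s • v}
      add_mem' := fun {v w} hv hw => by
        rw [Set.mem_ofPred_eq] at hv hw ⊢
        rw [hadd, hv, hw, smul_add]
      zero_mem' := by simpa using hsmul 0 0
      smul_mem' := fun c v hv => by
        rw [Set.mem_ofPred_eq] at hv ⊢
        rw [hsmul, hv, smul_comm] }
  have hL {s : ℝ} {v : V} (hv : v ∈ L s) : κ v = s • v := hv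
  have iso {s : ℝ} (hs : s * s = 1) {v w : V} (hv : v ∈ L s) (hw : w ∈ L s) : B v w = 0 := by
    have := hanti v w
    rw [hL hv, hL hw] at this
    simp only [map_smul, LinearMap.smul_apply, smul_eq_mul, ← mul_assoc, hs, one_mul] at this
    linarith
  have dec (v : V) : ∃ a ∈ L 1, ∃ b ∈ L (-1), v = a + b := by
    have h2 : κ (-κ v) = -v := by rw [← neg_one_smul ℝ, hsmul, hsq, neg_one_smul]
    refine ⟨(1 / 2 : ℝ) • (v + κ v), ?_, (1 / 2 : ℝ) • (v + -κ v), ?_, by module⟩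
    · change κ _ = _
      rw [hsmul, hadd, hsq]; module
    · change κ _ = _
      rw [hsmul, hadd, h2]; module
  let f (s t : ℝ) : L s →ₗ[ℝ] Module.Dual ℝ (L t) := B.domRestrict₁₂ (L s) (L t)
  have hf {s : ℝ} (hs : s = 1 ∨ s = -1) : Function.Injective (f s (-s)) := by
    rw [injective_iff_map_eq_zero]
    intro a ha
    refine Subtype.ext (hnd _ fun w => ?_)
    have ha' {b : V} (hb : b ∈ L (-s)) : B a b = 0 := DFunLike.congr_fun ha ⟨b, hb⟩
    obtain ⟨p, hp, q, hq, rfl⟩ := dec w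
    rcases hs with rfl | rfl
    · rw [map_add, iso (by norm_num) a.2 hp, ha' hq, add_zero]
    · rw [neg_neg] at ha'
      rw [map_add, ha' hp, iso (by norm_num) a.2 hq, add_zero]
  have h1 := hf (Or.inl rfl)
  have h2 := hf (Or.inr rfl)
  rw [neg_neg] at h2
  have hrank : Module.finrank ℝ (L (-1)) = Module.finrank ℝ (Module.Dual ℝ (L 1)) := by
    refine le_antisymm (LinearMap.finrank_le_finrank_of_injective h2) ?_
    have := LinearMap.finrank_le_finrank_of_injective h1
    rwa [Subspace.dual_finrank_eq] at this ⊢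
  let e : L (-1) ≃ₗ[ℝ] Module.Dual ℝ (L 1) := LinearEquiv.ofInjectiveOfFinrankEq _ h2 hrank
  let c := Module.finBasis ℝ (L 1)
  -- Chosen so that B(φ a, a) is the sum of the squares of the coordinates of `a` in the basis `c`.
  let φ : L 1 ≃ₗ[ℝ] L (-1) := c.toDualEquiv.trans e.symm
  have hφ (a : L 1) (ha : a ≠ 0) : 0 < B a (φ a) := by
    have h : B (φ a) a = c.toDual a a := by
      have h3 : e (φ a) = c.toDualEquiv a := e.apply_symm_apply _
      exact DFunLike.congr_fun h3 a
    rw [hsymm, h]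
    have h4 : c.toDual a a = ∑ i, c.repr a i * c.repr a i := by
      conv_lhs => rw [← c.sum_repr a]
      simp [Module.Basis.toDual_apply, -Module.Basis.sum_repr]
    rw [h4]
    refine lt_of_le_of_ne (Finset.sum_nonneg fun i _ => mul_self_nonneg _) fun h0 => ha ?_
    refine c.repr.map_eq_zero_iff.1 (Finsupp.ext fun i => ?_)
    exact mul_self_eq_zero.1
      ((Finset.sum_eq_zero_iff_of_nonneg fun i _ => mul_self_nonneg _).1 h0.symm i
        (Finset.mem_univ i))
  let g (s : ℝ) : L 1 →ₗ[ℝ] V := (L 1).subtype + s • (L (-1)).subtype ∘ₗ φ.toLinearMap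
  have hg (s : ℝ) (a : L 1) : g s a = a + s • (φ a : V) := rfl
  have hBg (s : ℝ) (a : L 1) : B (g s a) (g s a) = 2 * s * B a (φ a) := by
    rw [hg]
    simp only [map_add, map_smul, LinearMap.add_apply, LinearMap.smul_apply, smul_eq_mul,
      iso (one_mul 1) a.2 a.2, iso (by norm_num : (-1 : ℝ) * -1 = 1) (φ a).2 (φ a).2,
      hsymm (φ a) a]
    ring
  have hpos : ∀ v ∈ LinearMap.range (g 1), v ≠ 0 → 0 < B v v := by
    rintro _ ⟨a, rfl⟩ h
    have := hφ a (by rintro rfl; exact h (map_zero _))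
    rw [hBg]; linarith
  have hneg : ∀ v ∈ LinearMap.range (g (-1)), v ≠ 0 → B v v < 0 := by
    rintro _ ⟨a, rfl⟩ h
    have := hφ a (by rintro rfl; exact h (map_zero _))
    rw [hBg]; linarith
  have ginj {s : ℝ} (hs : s ≠ 0) : Function.Injective (g s) := by
    rw [injective_iff_map_eq_zero]
    intro a ha
    by_contra h
    have h3 := hBg s a
    rw [ha, map_zero] at h3
    exact (mul_ne_zero (mul_ne_zero two_ne_zero hs) (hφ a h).ne') h3.symm
  refine ⟨LinearMap.range (g 1), LinearMap.range (g (-1)), ⟨?_, ?_⟩, ?_, hpos, hneg⟩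
  · rw [Submodule.disjoint_def]
    intro v hv hv'
    by_contra h
    exact lt_asymm (hpos v hv h) (hneg v hv' h)
  · rw [codisjoint_iff, eq_top_iff]
    rintro v -
    obtain ⟨a, ha, b, hb, rfl⟩ := dec v
    obtain ⟨d, hd⟩ := φ.surjective ⟨b, hb⟩
    have hb' : b = φ d := by rw [hd]
    -- With b = φ d, the vector a + b is the sum of the points of the two graphs over (a + d)/2 and
    -- (a - d)/2.
    refine Submodule.mem_sup.2 ⟨_, ⟨(1 / 2 : ℝ) • (⟨a, ha⟩ + d), rfl⟩, _,
      ⟨(1 / 2 : ℝ) • (⟨a, ha⟩ - d), rfl⟩, ?_⟩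
    rw [hg, hg, hb']
    simp only [map_smul, map_add, map_sub, Submodule.coe_smul, Submodule.coe_add,
      Submodule.coe_sub]
    module
  · rw [LinearMap.finrank_range_of_inj (ginj one_ne_zero),
      LinearMap.finrank_range_of_inj (ginj (neg_ne_zero.2 one_ne_zero))]

variable [IsManifold 𝓘(ℝ, E) ∞ M]

/-- A generalized metric commuting with a para-complex structure is of split signature. -/
lemma IsGenMetric.isSplit [FiniteDimensional ℝ E] {G K : GEnd E M} (hG : IsGenMetric G)
    (hK : IsAlmostGpC K) (hcomm : G.comp K = K.comp G) : G.IsSplit := by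
  intro x
  have : FiniteDimensional ℝ (TangentSpace 𝓘(ℝ, E) x) := inferInstanceAs (FiniteDimensional ℝ E)
  -- The inverse of the anchor on C₊: ξ + Gξ is fixed by G, and for ξ = ηX its tangent part is η⁻¹ηX
  -- = X.
  let s (X : TangentSpace 𝓘(ℝ, E) x) : GTan (E := E) x := (0, G.metric x X) + G x (0, G.metric x X)
  have s_fst (X) : (s X).1 = X := by
    change (0 : TangentSpace 𝓘(ℝ, E) x) + G.block x (G.metric x X) = X
    rw [zero_add, hG.block_metric]
  have s_mem (X) : G x (s X) = s X := by
    rw [G.apply_add, hG.sq, add_comm]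
  have s_unique {X} {w : GTan (E := E) x} (hw : G x w = w) (h : w.1 = X) : w = s X :=
    (hG.nondeg_plus x).injOn hw (s_mem X) (h.trans (s_fst X).symm)
  have s_add (X Y) : s (X + Y) = s X + s Y := by
    refine (s_unique ?_ ?_).symm
    · rw [G.apply_add, s_mem, s_mem]
    · rw [Prod.fst_add, s_fst, s_fst]
  have s_smul (c : ℝ) (X) : s (c • X) = c • s X := by
    refine (s_unique ?_ ?_).symm
    · rw [G.apply_smul, s_mem]
    · rw [Prod.smul_fst, s_fst]
  have s_K (X) : K x (s X) = s (K x (s X)).1 :=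
    s_unique (by rw [GEnd.apply_comm hcomm, s_mem]) rfl
  -- G is self-adjoint and fixes sY, so both summands of sX pair with sY in the same way. Hence η is
  -- half the pairing transported from C₊, and K transports to an anti-isometry of it.
  have s_pairing (X Y) : pairing (s X) (s Y) = 2 * G.metric x X Y := by
    have h1 : pairing (s X) (s Y) =
        pairing (0, G.metric x X) (s Y) + pairing (G x (0, G.metric x X)) (s Y) :=
      pairing_add_left _ _ _
    rw [h1, hG.self_adjoint, s_mem]
    simp only [pairing, s_fst, map_zero]
    ring
  refine exists_isCompl_pos_neg (LinearMap.mk₂ ℝ (fun X Y => G.metric x X Y)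
    (fun X Y Z => by rw [map_add]; rfl) (fun c X Y => by rw [map_smul]; rfl)
    (fun X => (G.metric x X).map_add) (fun c X => (G.metric x X).map_smul c))
    (fun X Y => ?_) (fun X hX => ?_) (fun X => (K x (s X)).1) (fun X Y => ?_) (fun c X => ?_)
    (fun X => ?_) (fun X Y => ?_)
  · have h1 := s_pairing X Y
    rw [pairing_comm, s_pairing] at h1
    change G.metric x X Y = G.metric x Y X
    linarith
  · have h1 : G.metric x X = 0 := ContinuousLinearMap.ext hX
    rw [← hG.block_metric X, h1, map_zero]
  · rw [s_add, K.apply_add]; rfl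
  · rw [s_smul, K.apply_smul]; rfl
  · rw [← s_K, hK.sq, s_fst]
  · have h1 := s_pairing (K x (s X)).1 (K x (s Y)).1
    rw [← s_K, ← s_K, hK.anti, s_pairing] at h1
    change G.metric x _ _ = -G.metric x X Y
    linarith

lemma GEnd.comp_comp_left {K L : GEnd E M} (hK : IsAlmostGpC K) (hcomm : K.comp L = L.comp K) :
    (K.comp L).comp K = L := by
  funext x
  refine ContinuousLinearMap.ext fun w => ?_
  change K x (L x (K x w)) = L x w
  rw [GEnd.apply_comm hcomm, hK.sq]

omit [IsManifold 𝓘(ℝ, E) ∞ M] in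
lemma GEnd.comp_left_comm {K L : GEnd E M} (hcomm : K.comp L = L.comp K) :
    (K.comp L).comp K = K.comp (K.comp L) := by
  conv_rhs => rw [hcomm]
  rfl

end

end GenGeom

end

/-! ### The main equivalence -/

theorem mainTheorem4
    {E : Type*} [NormedAddCommGroup E] [NormedSpace ℝ E] [FiniteDimensional ℝ E]
    {M : Type*} [TopologicalSpace M] [T2Space M] [ChartedSpace E M] [IsManifold 𝓘(ℝ, E) ∞ M]
    (H : GenGeom.Form E M 3) (hH : H.IsSmooth) (hdH : H.d = 0)
    (Kp Km : GenGeom.GEnd E M)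
    (hKp : GenGeom.IsAlmostGpC Kp) (hKm : GenGeom.IsAlmostGpC Km)
    (hcomm : Kp.comp Km = Km.comp Kp)
    (hG : GenGeom.IsGenMetric (Kp.comp Km)) :
    (GenGeom.IsGpK H (Kp.comp Km) Kp ↔
      (GenGeom.IsParallel (GenGeom.bismut H (Kp.comp Km)) Kp ∧
        GenGeom.IsParallel (GenGeom.bismut H (Kp.comp Km)) Km ∧
        GenGeom.IsOfType21Add12
          (GenGeom.genTorsion H (GenGeom.bismut H (Kp.comp Km))) Kp ∧
        GenGeom.IsOfType21Add12
          (GenGeom.genTorsion H (GenGeom.bismut H (Kp.comp Km))) Km)) ∧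
    ((GenGeom.IsCourantIntegrable H Kp ∧ GenGeom.IsCourantIntegrable H Km) ↔
      (GenGeom.IsParallel (GenGeom.bismut H (Kp.comp Km)) Kp ∧
        GenGeom.IsParallel (GenGeom.bismut H (Kp.comp Km)) Km ∧
        GenGeom.IsOfType21Add12
          (GenGeom.genTorsion H (GenGeom.bismut H (Kp.comp Km))) Kp ∧
        GenGeom.IsOfType21Add12
          (GenGeom.genTorsion H (GenGeom.bismut H (Kp.comp Km))) Km)) := by
  have fwd (i : GenGeom.IsCourantIntegrable H Kp ∧ GenGeom.IsCourantIntegrable H Km) :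
      GenGeom.IsParallel (GenGeom.bismut H (Kp.comp Km)) Kp ∧
        GenGeom.IsParallel (GenGeom.bismut H (Kp.comp Km)) Km ∧
        GenGeom.IsOfType21Add12
          (GenGeom.genTorsion H (GenGeom.bismut H (Kp.comp Km))) Kp ∧
        GenGeom.IsOfType21Add12
          (GenGeom.genTorsion H (GenGeom.bismut H (Kp.comp Km))) Km := by
    have hp := GenGeom.isParallel_bismut hKp hcomm hG i.1 i.2
    -- The two structures play symmetric roles, since G is their product in either order.
    have hm := GenGeom.isParallel_bismut hKm hcomm.symm (hcomm ▸ hG) i.2 i.1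
    rw [← hcomm] at hm
    exact ⟨hp, hm, GenGeom.isOfType_bismut H hG hKp hp i.1, GenGeom.isOfType_bismut H hG hKm hm i.2⟩
  have bwd (h : GenGeom.IsParallel (GenGeom.bismut H (Kp.comp Km)) Kp ∧
        GenGeom.IsParallel (GenGeom.bismut H (Kp.comp Km)) Km ∧
        GenGeom.IsOfType21Add12
          (GenGeom.genTorsion H (GenGeom.bismut H (Kp.comp Km))) Kp ∧
        GenGeom.IsOfType21Add12
          (GenGeom.genTorsion H (GenGeom.bismut H (Kp.comp Km))) Km) :
      GenGeom.IsCourantIntegrable H Kp ∧ GenGeom.IsCourantIntegrable H Km :=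
    ⟨GenGeom.isCourantIntegrable_of_isOfType H hG hKp h.1 h.2.2.1,
      GenGeom.isCourantIntegrable_of_isOfType H hG hKm h.2.1 h.2.2.2⟩
  have hcomm' := GenGeom.GEnd.comp_left_comm hcomm
  have hleft := GenGeom.GEnd.comp_comp_left hKp hcomm
  -- By `hleft`, GK₊ = K₋, so the two integrability conditions of GpK are those of K₊ and K₋.
  refine ⟨⟨fun h => fwd ⟨h.integrable, hleft ▸ h.integrable'⟩, fun h => ?_⟩, fwd, bwd⟩
  exact ⟨hG, hG.isSplit hKp hcomm', hKp, hcomm', (bwd h).1, hleft.symm ▸ (bwd h).2⟩
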